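/- Let $f:[0,1]^2\to\mathbb R$ be a function such that the partial derivatives $f'_x$, $f'_y$ and the pure second partial derivatives $f''_{xx}=(f'_x)'_x$ and $f''_{yy}=(f'_y)'_y$ exist and are finite at every point of $[0,1]^2$ (all derivatives being one-sided at end points of $[0,1]$). Then there exists a set $G\subseteq[0,1]^2$, open in $[0,1]^2$ and dense in $[0,1]^2$, such that at almost every point of $G$ (with respect to two-dimensional Lebesgue measure) the mixed partial derivatives $f''_{xy}=(f'_x)'_y$ and $f''_{yx}=(f'_y)'_x$ exist, are finite, and are equal. -/

import Mathlib

open Set MeasureTheory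

namespace UnitSquare

/-- The closed unit square `[0,1]²`. -/
def square : Set (ℝ × ℝ) := Icc (0 : ℝ) 1 ×ˢ Icc (0 : ℝ) 1

/-- The first-order partial derivative in the first variable exists (finite) at `(x, y)`, for `f`
regarded as a function on `[0,1]²`: difference quotients use points of `[0,1]` only, so the
derivative is one-sided at the end points. -/
def HasDx (f : ℝ → ℝ → ℝ) (x y : ℝ) : Prop :=
  DifferentiableWithinAt ℝ (fun s => f s y) (Icc 0 1) x

/-- The partial derivative in the second variable exists at `(x, y)`. -/
def HasDy (f : ℝ → ℝ → ℝ) (x y : ℝ) : Prop :=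
  DifferentiableWithinAt ℝ (fun t => f x t) (Icc 0 1) y

/-- The partial derivative in the first variable of `f` on `[0,1]²`
(meaningful where `HasDx f x y` holds). -/
noncomputable def Dx (f : ℝ → ℝ → ℝ) (x y : ℝ) : ℝ :=
  derivWithin (fun s => f s y) (Icc 0 1) x

/-- The partial derivative in the second variable of `f` on `[0,1]²`
(meaningful where `HasDy f x y` holds). -/
noncomputable def Dy (f : ℝ → ℝ → ℝ) (x y : ℝ) : ℝ :=
  derivWithin (fun t => f x t) (Icc 0 1) y

end UnitSquare

open Filter Topology

/-! The core is the identity ∫ g_xy² = ∫ g_xx g_yy for compactly supported g: bounded pure second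
derivatives force a mixed derivative in L². Since no mixed derivative is known to exist, the
identity is used for finite differences (`integral_sq_mixed_difference`). The mixed difference
quotients are then bounded in L², and a weak cluster point V satisfies g(x, y) = ∫ V over the
quadrant (-∞, x] × (-∞, y] (`exists_integrable_mixed_density`). Fubini and Lebesgue differentiation
give ∂_y g_x = V almost everywhere, and by symmetry ∂_x g_y = V with the same V
(`ae_exists_hasDerivAt_mixed`).

The second derivatives of f are finite but possibly unbounded. Baire's theorem, applied once for
each variable, finds inside every open rectangle a smaller one on which f, its first derivatives and
its pure second derivatives are bounded (`exists_rectangle_bounded`). There f times a smooth cutoff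
falls under the case above (`ae_mixed_near_of_bounded`). So good open sets exist in every open
rectangle inside the square, and G is the union of them all. -/

/-! ### An L² mixed density for compactly supported functions -/

/-- Banach–Alaoglu: w is the weak limit along a nonprincipal ultrafilter, so neither a subsequence
nor separability is needed. -/
theorem exists_forall_inner_eq_of_tendsto {H : Type*} [NormedAddCommGroup H]
    [InnerProductSpace ℝ H] [CompleteSpace H] (v : ℕ → H) (C : ℝ) (hv : ∀ n, ‖v n‖ ≤ C) :
    ∃ w : H, ∀ (φ : H) (a : ℝ), Tendsto (fun n => inner ℝ (v n) φ) atTop (𝓝 a) →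
      inner ℝ w φ = a := by
  have hK := WeakDual.isCompact_closedBall (𝕜 := ℝ) (E := H) 0 C
  let T : ℕ → WeakDual ℝ H := fun n => StrongDual.toWeakDual (InnerProductSpace.toDual ℝ H (v n))
  have hT : ∀ n, T n ∈ (WeakDual.toStrongDual ⁻¹' Metric.closedBall (0 : StrongDual ℝ H) C) := by
    intro n
    simp only [mem_preimage, mem_closedBall_zero_iff]
    exact ((InnerProductSpace.toDual ℝ H).norm_map (v n)).trans_le (hv n)
  obtain ⟨L, -, hL⟩ := hK.ultrafilter_le_nhds ((hyperfilter ℕ).map T)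
    (by
      rw [le_principal_iff]
      exact Ultrafilter.mem_coe.2 (Filter.mem_map.2 (Filter.mem_of_superset univ_mem fun n _ => hT n)))
  refine ⟨(InnerProductSpace.toDual ℝ H).symm (WeakDual.toStrongDual L), fun φ a ha => ?_⟩
  have h1 : Tendsto (fun n => T n φ) (hyperfilter ℕ) (𝓝 (L φ)) :=
    ((WeakDual.eval_continuous φ).tendsto L).comp hL
  have h2 : Tendsto (fun n => T n φ) (hyperfilter ℕ) (𝓝 a) :=
    ha.mono_left Nat.hyperfilter_le_atTop
  rw [InnerProductSpace.toDual_symm_apply]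
  exact tendsto_nhds_unique h1 h2

section Translation

variable {U W : ℝ × ℝ → ℝ}

theorem HasCompactSupport.comp_add_const (h : HasCompactSupport U) (k : ℝ × ℝ) :
    HasCompactSupport fun p => U (p + k) :=
  h.comp_homeomorph (Homeomorph.addRight k)

/-- Discrete integration by parts. -/
theorem integral_difference_mul_difference (hU : Continuous U) (hUs : HasCompactSupport U)
    (hW : Continuous W) (k : ℝ × ℝ) :
    ∫ p, (U (p + k) - U p) * (W (p + k) - W p) =
      -∫ p, U p * (W (p + k) - 2 * W p + W (p - k)) := by
  have int (A B : ℝ × ℝ → ℝ) (hA : Continuous A) (hAs : HasCompactSupport A)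
      (hB : Continuous B) : Integrable fun p => A p * B p :=
    (hA.mul hB).integrable_of_hasCompactSupport (hAs.mul_right)
  have hUk : Continuous fun p => U (p + k) := by fun_prop
  have hWk : Continuous fun p => W (p + k) := by fun_prop
  have hWk' : Continuous fun p => W (p - k) := by fun_prop
  have hUks := hUs.comp_add_const k
  have e1 : ∫ p, U (p + k) * W (p + k) = ∫ p, U p * W p :=
    integral_add_right_eq_self (fun p => U p * W p) k
  have e2 : ∫ p, U (p + k) * W p = ∫ p, U p * W (p - k) := by
    rw [← integral_add_right_eq_self (fun p => U p * W (p - k)) k]; simp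
  have l : ∫ p, (U (p + k) - U p) * (W (p + k) - W p) =
      (∫ p, U (p + k) * W (p + k)) - (∫ p, U (p + k) * W p) - (∫ p, U p * W (p + k))
        + ∫ p, U p * W p := by
    rw [← integral_sub (int _ _ hUk hUks hWk) (int _ _ hUk hUks hW), ← integral_sub,
      ← integral_add]
    · congr 1; ext p; ring
    · exact ((int _ _ hUk hUks hWk).sub (int _ _ hUk hUks hW)).sub (int _ _ hU hUs hWk)
    · exact int _ _ hU hUs hW
    · exact (int _ _ hUk hUks hWk).sub (int _ _ hUk hUks hW)
    · exact int _ _ hU hUs hWk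
  have r : ∫ p, U p * (W (p + k) - 2 * W p + W (p - k)) =
      (∫ p, U p * W (p + k)) - 2 * (∫ p, U p * W p) + ∫ p, U p * W (p - k) := by
    rw [← integral_const_mul, ← integral_sub (int _ _ hU hUs hWk), ← integral_add]
    · congr 1; ext p; ring
    · exact (int _ _ hU hUs hWk).sub ((int _ _ hU hUs hW).const_mul 2)
    · exact int _ _ hU hUs hWk'
    · exact (int _ _ hU hUs hW).const_mul 2
  rw [l, r, e1, e2]; ring

/-- The discrete form of ∫ U_xy² = ∫ U_xx U_yy: one summation by parts in direction k, then one in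
direction h. -/
theorem integral_sq_mixed_difference (hU : Continuous U) (hUs : HasCompactSupport U)
    (h k : ℝ × ℝ) :
    ∫ p, (U (p + h + k) - U (p + k) - (U (p + h) - U p)) ^ 2 =
      ∫ p, (U (p + h) - 2 * U p + U (p - h)) * (U (p + k) - 2 * U p + U (p - k)) := by
  have c1 : Continuous fun p => U (p + h) - U p := by fun_prop
  have s1 : HasCompactSupport fun p => U (p + h) - U p := (hUs.comp_add_const h).sub hUs
  have c2 : Continuous fun p => U (p + k) - 2 * U p + U (p - k) := by fun_prop
  have s2 : HasCompactSupport fun p => U (p + k) - 2 * U p + U (p - k) := by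
    have := ((hUs.comp_add_const k).sub (hUs.mul_left (f := fun _ => 2))).add
      (hUs.comp_add_const (-k))
    exact this
  have a := integral_difference_mul_difference c1 s1 c1 k
  have b := integral_difference_mul_difference c2 s2 hU h
  calc _ = ∫ p, (U (p + k + h) - U (p + k) - (U (p + h) - U p)) *
        (U (p + k + h) - U (p + k) - (U (p + h) - U p)) := by
        congr 1; ext p; rw [add_right_comm p h k]; ring
    _ = -∫ p, (U (p + h + k) - 2 * U (p + h) + U (p + h - k) - (U (p + k) - 2 * U p + U (p - k)))
          * (U (p + h) - U p) := by
        rw [a]; congr 2; ext p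
        rw [add_right_comm p h k, sub_add_eq_add_sub p k h]; ring
    _ = _ := by rw [b, neg_neg]; congr 1; ext p; ring

end Translation

theorem setIntegral_Iic_difference {F : ℝ → ℝ} (hF : Continuous F) (hFs : HasCompactSupport F)
    (x h : ℝ) :
    ∫ s in Iic x, (F (s + h) - F s) = h * ∫ s in (0 : ℝ)..1, F (x + h * s) := by
  have hi : Integrable F := hF.integrable_of_hasCompactSupport hFs
  have e : ∫ s in Iic x, F (s + h) = ∫ s in Iic (x + h), F s := by
    rw [← integral_indicator measurableSet_Iic, ← integral_indicator measurableSet_Iic,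
      ← integral_add_right_eq_self ((Iic (x + h)).indicator F) h]
    congr 1; ext s; simp [indicator]
  rw [integral_sub (hi.comp_add_right h).integrableOn hi.integrableOn, e,
    intervalIntegral.integral_Iic_sub_Iic hi.integrableOn hi.integrableOn,
    intervalIntegral.mul_integral_comp_add_mul]
  simp

/-- The one-variable formula in each variable, joined by Fubini. After division by h² the right side
is an average of g over a square with corner (x, y), which tends to g(x, y) as h → 0. -/
theorem setIntegral_Iic_prod_mixed_difference {g : ℝ × ℝ → ℝ} (hg : Continuous g)
    (hgs : HasCompactSupport g) (x y h : ℝ) :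
    ∫ p in Iic x ×ˢ Iic y, (g (p + (h, 0) + (0, h)) - g (p + (0, h)) - (g (p + (h, 0)) - g p)) =
      h ^ 2 * ∫ s in (0 : ℝ)..1, ∫ t in (0 : ℝ)..1, g (x + h * s, y + h * t) := by
  obtain ⟨R, hR⟩ := hgs.isCompact.isBounded.subset_closedBall 0
  have hz : ∀ a b : ℝ, R < |a| ∨ R < |b| → g (a, b) = 0 := by
    intro a b hab
    by_contra hne
    have := hR (subset_tsupport g hne)
    rw [mem_closedBall_zero_iff, Prod.norm_def, max_le_iff] at this
    rcases hab with hab | hab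
    · exact absurd this.1 (not_le.2 hab)
    · exact absurd this.2 (not_le.2 hab)
  have hcs1 (a : ℝ) : HasCompactSupport fun t => g (a, t) :=
    HasCompactSupport.intro (isCompact_closedBall (0 : ℝ) R) fun t ht =>
      hz _ _ (Or.inr (by simpa using ht))
  let Φ : ℝ → ℝ := fun s => ∫ t in (0 : ℝ)..1, g (s, y + h * t)
  have hΦ : Continuous Φ := intervalIntegral.continuous_parametric_intervalIntegral_of_continuous'
    (f := fun s t => g (s, y + h * t)) (by simp only [Function.uncurry_def]; fun_prop) 0 1
  have hΦs : HasCompactSupport Φ :=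
    HasCompactSupport.intro (isCompact_closedBall (0 : ℝ) R) fun s hs => by
      have : ∀ t, g (s, y + h * t) = 0 := fun t => hz _ _ (Or.inl (by simpa using hs))
      simp [Φ, this]
  have hc : Continuous fun p : ℝ × ℝ =>
      g (p + (h, 0) + (0, h)) - g (p + (0, h)) - (g (p + (h, 0)) - g p) := by fun_prop
  have hs : HasCompactSupport fun p : ℝ × ℝ =>
      g (p + (h, 0) + (0, h)) - g (p + (0, h)) - (g (p + (h, 0)) - g p) :=
    (((hgs.comp_add_const (0, h)).comp_add_const (h, 0)).sub (hgs.comp_add_const (0, h))).sub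
      ((hgs.comp_add_const (h, 0)).sub hgs)
  rw [Measure.volume_eq_prod, setIntegral_prod]
  swap
  · exact (hc.integrable_of_hasCompactSupport hs).integrableOn
  have inner : ∀ s : ℝ, ∫ t in Iic y, (g ((s, t) + (h, 0) + (0, h)) - g ((s, t) + (0, h)) -
      (g ((s, t) + (h, 0)) - g (s, t))) = h * (Φ (s + h) - Φ s) := by
    intro s
    have := setIntegral_Iic_difference (F := fun t => g (s + h, t) - g (s, t)) (by fun_prop)
      ((hcs1 (s + h)).sub (hcs1 s)) y h
    simp only [Prod.mk_add_mk, add_zero]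
    rw [intervalIntegral.integral_sub] at this
    · rw [← this]
    · exact Continuous.intervalIntegrable (by fun_prop) _ _
    · exact Continuous.intervalIntegrable (by fun_prop) _ _
  simp_rw [inner]
  rw [integral_const_mul, setIntegral_Iic_difference hΦ hΦs]
  ring

theorem exists_integrable_mixed_density {g : ℝ × ℝ → ℝ} (hg : Continuous g)
    (hgs : HasCompactSupport g) (M : ℝ)
    (hx : ∀ p h, |g (p + (h, 0)) - 2 * g p + g (p - (h, 0))| ≤ M * h ^ 2)
    (hy : ∀ p h, |g (p + (0, h)) - 2 * g p + g (p - (0, h))| ≤ M * h ^ 2) :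
    ∃ V : ℝ × ℝ → ℝ, Integrable V ∧ ∀ x y, ∫ p in Iic x ×ˢ Iic y, V p = g (x, y) := by
  obtain ⟨R, hR⟩ := hgs.isCompact.isBounded.subset_closedBall 0
  have hz : ∀ p, R < ‖p‖ → g p = 0 := by
    intro p hp
    by_contra hne
    exact absurd (mem_closedBall_zero_iff.1 (hR (subset_tsupport g hne))) (not_le.2 hp)
  -- The margin 2 covers every shift used below, since the steps `δ n` are at most 1.
  let B : Set (ℝ × ℝ) := Metric.closedBall 0 (R + 2)
  have hBm : MeasurableSet B := measurableSet_closedBall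
  have hzB : ∀ p ∉ B, ∀ q : ℝ × ℝ, ‖q‖ ≤ 2 → g (p + q) = 0 := by
    intro p hp q hq
    apply hz
    have hp' : R + 2 < ‖p‖ := by simpa [B] using hp
    have := norm_sub_le (p + q) q
    rw [add_sub_cancel_right] at this
    linarith
  let δ : ℕ → ℝ := fun n => 1 / ((n : ℝ) + 1)
  have δpos : ∀ n, 0 < δ n := fun n => by positivity
  have δle : ∀ n, δ n ≤ 1 := fun n => by
    rw [div_le_one (by positivity)]; linarith [(n.cast_nonneg : (0 : ℝ) ≤ n)]
  have δlim : Tendsto δ atTop (𝓝 0) := tendsto_one_div_add_atTop_nhds_zero_nat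
  let D : ℝ → ℝ × ℝ → ℝ := fun h p =>
    g (p + (h, 0) + (0, h)) - g (p + (0, h)) - (g (p + (h, 0)) - g p)
  have hDc : ∀ h, Continuous (D h) := fun h => by fun_prop
  have hDs : ∀ h, HasCompactSupport (D h) := fun h =>
    (((hgs.comp_add_const (0, h)).comp_add_const (h, 0)).sub (hgs.comp_add_const (0, h))).sub
      ((hgs.comp_add_const (h, 0)).sub hgs)
  have nrm1 : ∀ n, ‖((δ n, 0) : ℝ × ℝ)‖ ≤ 1 := fun n => by
    simp [Prod.norm_def, abs_of_pos (δpos n), δle n]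
  have nrm2 : ∀ n, ‖((0, δ n) : ℝ × ℝ)‖ ≤ 1 := fun n => by
    simp [Prod.norm_def, abs_of_pos (δpos n), δle n]
  have hDz : ∀ n, ∀ p ∉ B, D (δ n) p = 0 := by
    intro n p hp
    have a1 := hzB p hp _ ((nrm1 n).trans one_le_two)
    have a2 := hzB p hp _ ((nrm2 n).trans one_le_two)
    have a3 := hzB p hp 0 (by simp)
    have a4 := hzB p hp ((δ n, 0) + (0, δ n))
      ((norm_add_le _ _).trans (by linarith [nrm1 n, nrm2 n]))
    rw [← add_assoc] at a4
    rw [add_zero] at a3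
    simp only [D, a1, a2, a3, a4, sub_zero]
  -- On the finite measure `μ` indicators of quadrants lie in L², so they can serve as test
  -- functions.
  let μ : Measure (ℝ × ℝ) := volume.restrict B
  have : IsFiniteMeasure μ :=
    ⟨by simpa [μ] using (isCompact_closedBall (0 : ℝ × ℝ) (R + 2)).measure_lt_top⟩
  let v : ℕ → ℝ × ℝ → ℝ := fun n p => (δ n ^ 2)⁻¹ * D (δ n) p
  have hv : ∀ n, MemLp (v n) 2 μ := fun n =>
    ((hDc (δ n)).memLp_of_hasCompactSupport (hDs (δ n))).const_mul _
  have hM : 0 ≤ M := by simpa using (abs_nonneg _).trans (hx 0 1)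
  have sq : ∀ n, ∫ p, v n p ^ 2 ∂μ ≤ M ^ 2 * volume.real B := by
    intro n
    have e1 : ∫ p, v n p ^ 2 ∂μ = (δ n ^ 4)⁻¹ * ∫ p, D (δ n) p ^ 2 := by
      rw [← integral_const_mul]
      rw [setIntegral_eq_integral_of_forall_compl_eq_zero]
      · congr 1; ext p
        simp only [v, mul_pow, inv_pow, ← pow_mul]
      · intro p hp
        simp [v, hDz n p hp]
    rw [e1, inv_mul_le_iff₀ (pow_pos (δpos n) 4)]
    have e2 := integral_sq_mixed_difference hg hgs (δ n, 0) (0, δ n)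
    change ∫ p, D (δ n) p ^ 2 = _ at e2
    rw [e2, ← setIntegral_eq_integral_of_forall_compl_eq_zero (s := B)]
    · refine (le_abs_self _).trans ?_
      have := norm_setIntegral_le_of_norm_le_const (μ := volume) (s := B)
        (C := (M * δ n ^ 2) * (M * δ n ^ 2))
        (f := fun p => (g (p + (δ n, 0)) - 2 * g p + g (p - (δ n, 0))) *
          (g (p + (0, δ n)) - 2 * g p + g (p - (0, δ n))))
        (isCompact_closedBall (0 : ℝ × ℝ) (R + 2)).measure_lt_top
        (fun p _ => by
          rw [norm_mul]
          exact mul_le_mul (hx p _) (hy p _) (norm_nonneg _) (by positivity))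
      refine this.trans (le_of_eq ?_)
      ring
    · intro p hp
      have a1 := hzB p hp _ ((nrm1 n).trans one_le_two)
      have a2 := hzB p hp (-(δ n, 0)) (by rw [norm_neg]; exact ((nrm1 n).trans one_le_two))
      have a3 := hzB p hp 0 (by simp)
      rw [← sub_eq_add_neg] at a2
      rw [add_zero] at a3
      simp only [a1, a2, a3, mul_zero, sub_zero, zero_mul, add_zero]
  have bd : ∀ n, ‖(hv n).toLp (v n)‖ ≤ √(M ^ 2 * volume.real B) := by
    intro n
    apply Real.le_sqrt_of_sq_le
    rw [← real_inner_self_eq_norm_sq, L2.inner_def]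
    refine le_trans (le_of_eq (integral_congr_ae ?_)) (sq n)
    filter_upwards [(hv n).coeFn_toLp] with p hp
    rw [hp]
    simp [pow_two]
  obtain ⟨w, hw⟩ := exists_forall_inner_eq_of_tendsto _ _ bd
  have hwi : Integrable w μ := (Lp.memLp w).integrable (by norm_num)
  refine ⟨B.indicator w, (integrable_indicator_iff hBm).2 hwi, fun x y => ?_⟩
  have hs : MeasurableSet (Iic x ×ˢ Iic y) := measurableSet_Iic.prod measurableSet_Iic
  have key := hw (indicatorConstLp 2 hs (measure_ne_top μ _) 1) (g (x, y)) ?_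
  · rw [real_inner_comm, L2.inner_indicatorConstLp_one] at key
    rw [setIntegral_indicator hBm, ← key, Measure.restrict_restrict hs]
  · have e : ∀ n, inner ℝ ((hv n).toLp (v n)) (indicatorConstLp 2 hs (measure_ne_top μ _) 1) =
        ∫ s in (0 : ℝ)..1, ∫ t in (0 : ℝ)..1, g (x + δ n * s, y + δ n * t) := by
      intro n
      rw [real_inner_comm, L2.inner_indicatorConstLp_one]
      have e1 : ∫ p in Iic x ×ˢ Iic y, (hv n).toLp (v n) p ∂μ =
          ∫ p in Iic x ×ˢ Iic y, v n p ∂μ :=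
        integral_congr_ae (ae_restrict_of_ae (hv n).coeFn_toLp)
      have e2 : ∫ p in Iic x ×ˢ Iic y, v n p ∂μ = ∫ p in Iic x ×ˢ Iic y, v n p := by
        rw [Measure.restrict_restrict hs]
        refine setIntegral_eq_of_subset_of_forall_sdiff_eq_zero hs inter_subset_left ?_ |>.symm
        rintro p ⟨hp, hp'⟩
        have : p ∉ B := fun h => hp' ⟨hp, h⟩
        simp [v, hDz n p this]
      rw [e1, e2, integral_const_mul, setIntegral_Iic_prod_mixed_difference hg hgs,
        inv_mul_cancel_left₀ (pow_pos (δpos n) 2).ne']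
    simp_rw [e]
    -- At h = 0 the average equals g(x, y), so continuity in h gives the limit.
    have hc : Continuous fun h : ℝ =>
        ∫ s in (0 : ℝ)..1, ∫ t in (0 : ℝ)..1, g (x + h * s, y + h * t) := by
      refine intervalIntegral.continuous_parametric_intervalIntegral_of_continuous'
        (f := fun h s => ∫ t in (0 : ℝ)..1, g (x + h * s, y + h * t)) ?_ 0 1
      refine intervalIntegral.continuous_parametric_intervalIntegral_of_continuous'
        (f := fun (q : ℝ × ℝ) t => g (x + q.1 * q.2, y + q.1 * t)) ?_ 0 1
      simp only [Function.uncurry_def]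
      fun_prop
    have := (hc.tendsto 0).comp δlim
    simpa [Function.comp_def] using this

/-! ### One-variable estimates from a Lipschitz derivative -/

section LipschitzDeriv

variable {S : Set ℝ} {F F' : ℝ → ℝ} {M : ℝ}

/-- The increments over `h` of a function with Lipschitz derivative. -/
theorem abs_increment_sub_increment_le (hS : S.OrdConnected)
    (hF : ∀ x ∈ S, HasDerivAt F (F' x) x)
    (hL : ∀ x ∈ S, ∀ x' ∈ S, |F' x - F' x'| ≤ M * |x - x'|) {x x' h : ℝ} (hx : x ∈ S)
    (hx' : x' ∈ S) (hxh : x + h ∈ S) (hxh' : x' + h ∈ S) :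
    |(F (x + h) - F x) - (F (x' + h) - F x')| ≤ M * |x - x'| * |h| := by
  have mem : ∀ z ∈ S, z + h ∈ S → ∀ s ∈ uIcc 0 h, z + s ∈ S := by
    intro z hz hzh s hs
    apply hS.uIcc_subset hz hzh
    have : z + s ∈ Set.image (fun t => z + t) (uIcc 0 h) := mem_image_of_mem _ hs
    rw [image_const_add_uIcc] at this
    simpa using this
  have := (convex_uIcc (𝕜 := ℝ) (0 : ℝ) h).norm_image_sub_le_of_norm_hasDerivWithin_le
    (f := fun s => F (x + s) - F (x' + s)) (f' := fun s => F' (x + s) - F' (x' + s))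
    (C := M * |x - x'|)
    (fun s hs => (((hF _ (mem x hx hxh s hs)).comp_const_add x s).sub
      ((hF _ (mem x' hx' hxh' s hs)).comp_const_add x' s)).hasDerivWithinAt)
    (fun s hs => by
      have := hL _ (mem x hx hxh s hs) _ (mem x' hx' hxh' s hs)
      rwa [add_sub_add_right_eq_sub] at this)
    left_mem_uIcc right_mem_uIcc
  simp only [add_zero, sub_zero, Real.norm_eq_abs] at this
  convert! this using 2
  ring

theorem abs_sub_sub_deriv_mul_le (hF : ∀ x, HasDerivAt F (F' x) x)
    (hL : ∀ x x', |F' x - F' x'| ≤ M * |x - x'|) (x h : ℝ) :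
    |F (x + h) - F x - F' x * h| ≤ M * |h| * |h| := by
  have hM : 0 ≤ M := by simpa using (abs_nonneg _).trans (hL 1 0)
  have := (convex_uIcc (𝕜 := ℝ) (0 : ℝ) h).norm_image_sub_le_of_norm_hasDerivWithin_le
    (f := fun s => F (x + s) - F' x * s) (f' := fun s => F' (x + s) - F' x)
    (C := M * |h|)
    (fun s _ => by
      have := ((hF _).comp_const_add x s).sub ((hasDerivAt_id s).const_mul (F' x))
      rw [mul_one] at this
      exact this.hasDerivWithinAt)
    (fun s hs => by
      refine (hL _ _).trans ?_
      rw [add_sub_cancel_left]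
      have := abs_sub_left_of_mem_uIcc hs
      rw [sub_zero, sub_zero] at this
      gcongr)
    left_mem_uIcc right_mem_uIcc
  simp only [add_zero, sub_zero, mul_zero, Real.norm_eq_abs] at this
  convert! this using 2
  ring

end LipschitzDeriv

/-! ### From the density to the mixed derivatives -/

/-- Joint continuity holds because u is the uniform limit of the continuous difference quotients of
g with step 1/(n+1); the error is at most M/(n+1). -/
theorem continuous_of_hasDerivAt_of_lipschitz {g u : ℝ × ℝ → ℝ} {M : ℝ} (hg : Continuous g)
    (hu : ∀ x y, HasDerivAt (fun s => g (s, y)) (u (x, y)) x)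
    (hul : ∀ x x' y, |u (x, y) - u (x', y)| ≤ M * |x - x'|) : Continuous u := by
  have hlim : TendstoUniformly (fun (n : ℕ) (p : ℝ × ℝ) =>
      ((n : ℝ) + 1) * (g (p.1 + 1 / ((n : ℝ) + 1), p.2) - g p)) u atTop := by
    rw [Metric.tendstoUniformly_iff]
    intro ε hε
    have : Tendsto (fun n : ℕ => M * (1 / ((n : ℝ) + 1))) atTop (𝓝 0) := by
      simpa using tendsto_one_div_add_atTop_nhds_zero_nat.const_mul M
    filter_upwards [this.eventually_lt_const hε] with n hn p
    have hpos : (0 : ℝ) < (n : ℝ) + 1 := by positivity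
    have := abs_sub_sub_deriv_mul_le (fun x => hu x p.2) (fun x x' => hul x x' p.2) p.1
      (1 / ((n : ℝ) + 1))
    rw [abs_of_pos (one_div_pos.2 hpos)] at this
    rw [dist_comm, Real.dist_eq]
    refine lt_of_le_of_lt ?_ hn
    have e : ((n : ℝ) + 1) * (g (p.1 + 1 / ((n : ℝ) + 1), p.2) - g p) - u p =
        ((n : ℝ) + 1) * (g (p.1 + 1 / ((n : ℝ) + 1), p.2) - g (p.1, p.2)
          - u (p.1, p.2) * (1 / ((n : ℝ) + 1))) := by
      field_simp
    rw [e, abs_mul, abs_of_pos hpos]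
    calc _ ≤ ((n : ℝ) + 1) * (M * (1 / ((n : ℝ) + 1)) * (1 / ((n : ℝ) + 1))) := by gcongr
      _ = _ := by field_simp
  exact hlim.continuous (Frequently.of_forall fun n => by fun_prop)

/-- Differentiating the double integral in x gives, for each y, u(x, y) = ∫ V(x, t) dt over t ≤ y
for almost every x. For almost every x this holds at all rational y, hence at all y by continuity,
and Lebesgue differentiation in y applies. -/
theorem ae_hasDerivAt_of_mixed_density {g u V : ℝ × ℝ → ℝ} (hV : Integrable V)
    (hgV : ∀ x y, ∫ p in Iic x ×ˢ Iic y, V p = g (x, y)) (huc : Continuous u)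
    (hu : ∀ x y, HasDerivAt (fun s => g (s, y)) (u (x, y)) x) :
    ∀ᵐ p : ℝ × ℝ, HasDerivAt (fun t => u (p.1, t)) (V p) p.2 := by
  wlog hVm : StronglyMeasurable V generalizing V
  · have h := this (V := hV.1.mk V) (hV.congr hV.1.ae_eq_mk)
      (fun x y => by rw [← hgV]; exact integral_congr_ae (ae_restrict_of_ae hV.1.ae_eq_mk.symm))
      hV.1.stronglyMeasurable_mk
    filter_upwards [h, hV.1.ae_eq_mk] with p hp hp'
    rwa [hp']
  have step : ∀ y, ∀ᵐ x, u (x, y) = ∫ t in Iic y, V (x, t) := by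
    intro y
    have hi : Integrable (fun x => ∫ t in Iic y, V (x, t)) := by
      have : Integrable V (volume.prod (volume.restrict (Iic y))) := by
        have := hV.restrict (s := univ ×ˢ Iic y)
        rwa [Measure.volume_eq_prod, ← Measure.prod_restrict, Measure.restrict_univ] at this
      exact this.integral_prod_left
    filter_upwards [_root_.LocallyIntegrable.ae_hasDerivAt_integral hi.locallyIntegrable] with x hx
    have e : (fun x => ∫ s in (0 : ℝ)..x, ∫ t in Iic y, V (s, t)) =
        fun x => g (x, y) - g (0, y) := by
      ext x
      have (x : ℝ) : g (x, y) = ∫ s in Iic x, ∫ t in Iic y, V (s, t) := by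
        rw [← hgV, Measure.volume_eq_prod, setIntegral_prod]
        exact hV.integrableOn
      rw [this, this, intervalIntegral.integral_Iic_sub_Iic hi.integrableOn hi.integrableOn]
    have h0 := hx 0
    rw [e] at h0
    exact ((hu x y).sub_const _).unique h0
  have hae : ∀ᵐ x : ℝ, ∀ᵐ y : ℝ, HasDerivAt (fun t => u (x, t)) (V (x, y)) y := by
    have h1 : ∀ᵐ x : ℝ, ∀ q : ℚ, u (x, q) = ∫ t in Iic (q : ℝ), V (x, t) :=
      ae_all_iff.2 fun q => step q
    have h2 : ∀ᵐ x : ℝ, Integrable (fun t => V (x, t)) := by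
      rw [Measure.volume_eq_prod] at hV
      exact hV.prod_right_ae
    filter_upwards [h1, h2] with x hx1 hx2
    have e0 : ∀ y : ℝ, ∫ t in Iic y, V (x, t) =
        (∫ t in Iic (0 : ℝ), V (x, t)) + ∫ t in (0 : ℝ)..y, V (x, t) := fun y => by
      rw [← intervalIntegral.integral_Iic_sub_Iic hx2.integrableOn hx2.integrableOn]; ring
    have e : (fun y => u (x, y)) =
        fun y => (∫ t in Iic (0 : ℝ), V (x, t)) + ∫ t in (0 : ℝ)..y, V (x, t) := by
      refine Rat.denseRange_cast.equalizer (by fun_prop)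
        (continuous_const.add (intervalIntegral.continuous_primitive
          (fun _ _ => hx2.intervalIntegrable) 0)) ?_
      ext q
      simp only [Function.comp_apply]
      rw [hx1 q, e0]
    filter_upwards [_root_.LocallyIntegrable.ae_hasDerivAt_integral hx2.locallyIntegrable] with y hy
    rw [e]
    exact (hy 0).const_add _
  have hcu : Continuous (Function.uncurry fun x t => u (x, t)) := huc
  -- Measurability is what turns "for a.e. x, for a.e. y" into "for a.e. (x, y)".
  have hm : MeasurableSet {p : ℝ × ℝ | HasDerivAt (fun t => u (p.1, t)) (V p) p.2} := by
    have : {p : ℝ × ℝ | HasDerivAt (fun t => u (p.1, t)) (V p) p.2} =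
        {p : ℝ × ℝ | DifferentiableAt ℝ (fun t => u (p.1, t)) p.2} ∩
          {p | deriv (fun t => u (p.1, t)) p.2 = V p} := by
      ext p
      exact ⟨fun h => ⟨h.differentiableAt, h.deriv⟩, fun h => by
        have := h.1.hasDerivAt
        rwa [h.2] at this⟩
    rw [this]
    exact (measurableSet_of_differentiableAt_with_param ℝ hcu).inter
      (measurableSet_eq_fun (measurable_deriv_with_param hcu) hVm.measurable)
  rw [Measure.volume_eq_prod]
  exact (Measure.ae_prod_iff_ae_ae hm).2 hae

/-- Equality almost everywhere of the mixed derivatives of a compactly supported function whose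
partial derivatives `u` and `w` are Lipschitz in the direction of differentiation. -/
theorem ae_exists_hasDerivAt_mixed {g u w : ℝ × ℝ → ℝ} {M : ℝ} (hg : Continuous g)
    (hgs : HasCompactSupport g)
    (hu : ∀ x y, HasDerivAt (fun s => g (s, y)) (u (x, y)) x)
    (hul : ∀ x x' y, |u (x, y) - u (x', y)| ≤ M * |x - x'|)
    (hw : ∀ x y, HasDerivAt (fun t => g (x, t)) (w (x, y)) y)
    (hwl : ∀ x y y', |w (x, y) - w (x, y')| ≤ M * |y - y'|) :
    ∀ᵐ p : ℝ × ℝ, ∃ v, HasDerivAt (fun t => u (p.1, t)) v p.2 ∧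
      HasDerivAt (fun s => w (s, p.2)) v p.1 := by
  have second : ∀ {F F' : ℝ → ℝ}, (∀ x, HasDerivAt F (F' x) x) →
      (∀ x x', |F' x - F' x'| ≤ M * |x - x'|) → ∀ x h,
      |F (x + h) - 2 * F x + F (x - h)| ≤ M * h ^ 2 := by
    intro F F' hF hL x h
    -- The second difference is the increment at x minus the increment at x - h.
    have := abs_increment_sub_increment_le ordConnected_univ (fun x _ => hF x)
      (fun x _ x' _ => hL x x') (mem_univ x) (mem_univ (x - h)) (h := h) (mem_univ _) (mem_univ _)
    rw [sub_add_cancel, sub_sub_cancel, mul_assoc, abs_mul_abs_self, ← pow_two] at this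
    convert! this using 2
    ring
  obtain ⟨V, hV, hgV⟩ := exists_integrable_mixed_density hg hgs M
    (fun ⟨a, b⟩ h => by
      simpa using second (fun x => hu x b) (fun x x' => hul x x' b) a h)
    (fun ⟨a, b⟩ h => by
      simpa using second (fun y => hw a y) (fun y y' => hwl a y y') b h)
  have h1 := ae_hasDerivAt_of_mixed_density hV hgV
    (continuous_of_hasDerivAt_of_lipschitz hg hu hul) hu
  have hgs' : Continuous (g ∘ Prod.swap) := hg.comp continuous_swap
  -- With the variables exchanged the density is `V ∘ Prod.swap`, so one V represents both mixed
  -- derivatives.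
  have h2 := ae_hasDerivAt_of_mixed_density (g := g ∘ Prod.swap) (u := w ∘ Prod.swap)
    (V := V ∘ Prod.swap) hV.swap
    (fun x y => by
      have := setIntegral_prod_swap (μ := (volume : Measure ℝ)) (ν := (volume : Measure ℝ))
        (Iic y) (Iic x) V
      rw [← Measure.volume_eq_prod, hgV] at this
      exact this)
    (continuous_of_hasDerivAt_of_lipschitz hgs' (fun x y => hw y x)
      (fun x x' y => hwl y x x')) (fun x y => hw y x)
  have h3 := (Measure.measurePreserving_swap (μ := (volume : Measure ℝ))
    (ν := (volume : Measure ℝ))).quasiMeasurePreserving.ae h2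
  filter_upwards [h1, h3] with p hp1 hp2
  exact ⟨V p, hp1, hp2⟩

/-! ### Localisation by cutoff functions -/

theorem exists_forall_abs_deriv_le_of_hasCompactSupport {φ : ℝ → ℝ} (hφ : ContDiff ℝ 2 φ)
    (hs : HasCompactSupport φ) :
    ∃ K, ∀ x, |φ x| ≤ K ∧ |deriv φ x| ≤ K ∧ |deriv (deriv φ) x| ≤ K := by
  have h1 : ContDiff ℝ 1 (deriv φ) := (contDiff_succ_iff_deriv (n := 1)).1 hφ |>.2.2
  have h2 : Continuous (deriv (deriv φ)) := h1.continuous_deriv le_rfl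
  obtain ⟨A, hA⟩ := hs.exists_bound_of_continuous hφ.continuous
  obtain ⟨B, hB⟩ := hs.deriv.exists_bound_of_continuous h1.continuous
  obtain ⟨C, hC⟩ := hs.deriv.deriv.exists_bound_of_continuous h2
  exact ⟨max A (max B C), fun x => ⟨(hA x).trans (le_max_left _ _),
    (hB x).trans ((le_max_left _ _).trans (le_max_right _ _)),
    (hC x).trans ((le_max_right _ _).trans (le_max_right _ _))⟩⟩

/-- Multiplying by a cutoff function turns local bounds on two derivatives into global ones. -/
theorem hasDerivAt_and_lipschitz_cutoff_mul {φ F F' F'' : ℝ → ℝ} {S : Set ℝ} {K M : ℝ}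
    (hM0 : 0 ≤ M) (hφ : ContDiff ℝ 2 φ) (hsub : tsupport φ ⊆ S)
    (hK : ∀ x, |φ x| ≤ K ∧ |deriv φ x| ≤ K ∧ |deriv (deriv φ) x| ≤ K)
    (hF : ∀ x ∈ S, HasDerivAt F (F' x) x ∧ HasDerivAt F' (F'' x) x)
    (hM : ∀ x ∈ S, |F x| ≤ M ∧ |F' x| ≤ M ∧ |F'' x| ≤ M) :
    (∀ x, HasDerivAt (fun s => φ s * F s) (deriv φ x * F x + φ x * F' x) x) ∧
    ∀ x x', |(deriv φ x * F x + φ x * F' x) - (deriv φ x' * F x' + φ x' * F' x')| ≤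
      4 * (K * M) * |x - x'| := by
  have h1 : ContDiff ℝ 1 (deriv φ) := (contDiff_succ_iff_deriv (n := 1)).1 hφ |>.2.2
  have d0 : ∀ x, HasDerivAt φ (deriv φ x) x := fun x =>
    (hφ.differentiable (by norm_num) x).hasDerivAt
  have d1 : ∀ x, HasDerivAt (deriv φ) (deriv (deriv φ) x) x := fun x =>
    (h1.differentiable (by norm_num) x).hasDerivAt
  have z : ∀ x ∉ tsupport φ, φ =ᶠ[𝓝 x] 0 := fun x hx => notMem_tsupport_iff_eventuallyEq.1 hx
  have z1 : ∀ x ∉ tsupport φ, deriv φ =ᶠ[𝓝 x] 0 := fun x hx => by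
    have := (z x hx).deriv
    simpa using this
  have z2 : ∀ x ∉ tsupport φ, deriv (deriv φ) x = 0 := fun x hx => by
    have := (z1 x hx).deriv_eq
    simpa using this
  refine ⟨fun x => ?_, fun x x' => ?_⟩
  · by_cases hx : x ∈ tsupport φ
    · exact (d0 x).mul (hF x (hsub hx)).1
    · have e1 := (z x hx).eq_of_nhds
      have e2 := (z1 x hx).eq_of_nhds
      simp only [e1, e2, Pi.zero_apply, zero_mul, add_zero]
      refine (hasDerivAt_const x (0 : ℝ)).congr_of_eventuallyEq ?_
      filter_upwards [z x hx] with s hs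
      simp [hs]
  · let G' : ℝ → ℝ := fun x => deriv φ x * F x + φ x * F' x
    have hG : ∀ x, HasDerivAt G'
        (deriv (deriv φ) x * F x + deriv φ x * F' x + (deriv φ x * F' x + φ x * F'' x)) x := by
      intro x
      by_cases hx : x ∈ tsupport φ
      · exact ((d1 x).mul (hF x (hsub hx)).1).add ((d0 x).mul (hF x (hsub hx)).2)
      · have e1 := (z x hx).eq_of_nhds
        have e2 := (z1 x hx).eq_of_nhds
        simp only [e1, e2, z2 x hx, Pi.zero_apply, zero_mul, add_zero]
        refine (hasDerivAt_const x (0 : ℝ)).congr_of_eventuallyEq ?_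
        filter_upwards [z x hx, z1 x hx] with s hs hs'
        simp [G', hs, hs']
    -- The 4 counts the products in φ''F + φ'F' + φ'F' + φF'', each at most K M.
    have hbd : ∀ x,
        ‖deriv (deriv φ) x * F x + deriv φ x * F' x + (deriv φ x * F' x + φ x * F'' x)‖ ≤
          4 * (K * M) ∨ x ∉ tsupport φ := by
      intro x
      by_cases hx : x ∈ tsupport φ
      · left
        obtain ⟨a1, a2, a3⟩ := hM x (hsub hx)
        obtain ⟨b1, b2, b3⟩ := hK x
        have hK0 : 0 ≤ K := (abs_nonneg _).trans b1
        have m : ∀ {p q : ℝ}, |p| ≤ K → |q| ≤ M → ‖p * q‖ ≤ K * M := fun hp hq => by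
          rw [Real.norm_eq_abs, abs_mul]
          exact mul_le_mul hp hq (abs_nonneg _) hK0
        refine (norm_add_le_of_le (norm_add_le_of_le (m b3 a1) (m b2 a2))
          (norm_add_le_of_le (m b2 a2) (m b1 a3))).trans (le_of_eq ?_)
        ring
      · exact Or.inr hx
    have h0 : 0 ≤ 4 * (K * M) := by
      have := (abs_nonneg _).trans (hK 0).1
      positivity
    have := convex_univ.norm_image_sub_le_of_norm_hasDerivWithin_le (f := G')
      (C := 4 * (K * M)) (fun x _ => (hG x).hasDerivWithinAt)
      (fun x _ => (hbd x).elim id fun hx => by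
        have e1 := (z x hx).eq_of_nhds
        have e2 := (z1 x hx).eq_of_nhds
        simpa [e1, e2, z2 x hx] using h0) (mem_univ x') (mem_univ x)
    exact this

theorem exists_contDiff_eq_one_near {a b x₀ : ℝ} (hx₀ : x₀ ∈ Ioo a b) :
    ∃ φ : ℝ → ℝ, ContDiff ℝ 2 φ ∧ HasCompactSupport φ ∧ tsupport φ ⊆ Ioo a b ∧ (∀ x, |φ x| ≤ 1) ∧
      ∃ W : Set ℝ, IsOpen W ∧ x₀ ∈ W ∧ W ⊆ Ioo a b ∧ ∀ x ∈ W, φ x = 1 := by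
  obtain ⟨r, hr, hrs⟩ := Metric.nhds_basis_closedBall.mem_iff.1 (isOpen_Ioo.mem_nhds hx₀)
  let φ : ContDiffBump x₀ := ⟨r / 2, r, half_pos hr, half_lt_self hr⟩
  refine ⟨φ, φ.contDiff, φ.hasCompactSupport, φ.tsupport_eq.subset.trans hrs, fun x => ?_,
    Metric.ball x₀ (r / 2), Metric.isOpen_ball, Metric.mem_ball_self (half_pos hr), ?_, ?_⟩
  · rw [abs_of_nonneg φ.nonneg]
    exact φ.le_one
  · exact (Metric.ball_subset_closedBall.trans
      (Metric.closedBall_subset_closedBall (half_le_self hr.le))).trans hrs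
  · exact fun x hx => φ.one_of_mem_closedBall (Metric.ball_subset_closedBall hx)

/-- The product φ(x)ψ(y)f(x, y) satisfies the global hypotheses, and on the open set where both
cutoffs are 1 its first derivatives are those of f. -/
theorem ae_mixed_near_of_bounded {f fx fxx fy fyy : ℝ → ℝ → ℝ} {a b c d M : ℝ}
    (hx : ∀ x ∈ Ioo a b, ∀ y ∈ Ioo c d,
      HasDerivAt (fun s => f s y) (fx x y) x ∧ HasDerivAt (fun s => fx s y) (fxx x y) x)
    (hy : ∀ x ∈ Ioo a b, ∀ y ∈ Ioo c d,
      HasDerivAt (fun t => f x t) (fy x y) y ∧ HasDerivAt (fun t => fy x t) (fyy x y) y)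
    (hMx : ∀ x ∈ Ioo a b, ∀ y ∈ Ioo c d, |f x y| ≤ M ∧ |fx x y| ≤ M ∧ |fxx x y| ≤ M)
    (hMy : ∀ x ∈ Ioo a b, ∀ y ∈ Ioo c d, |f x y| ≤ M ∧ |fy x y| ≤ M ∧ |fyy x y| ≤ M)
    {x₀ y₀ : ℝ} (hx₀ : x₀ ∈ Ioo a b) (hy₀ : y₀ ∈ Ioo c d) :
    ∃ V : Set (ℝ × ℝ), IsOpen V ∧ (x₀, y₀) ∈ V ∧ V ⊆ Ioo a b ×ˢ Ioo c d ∧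
      ∀ᵐ p : ℝ × ℝ, p ∈ V → ∃ v, HasDerivAt (fun t => fx p.1 t) v p.2 ∧
        HasDerivAt (fun s => fy s p.2) v p.1 := by
  obtain ⟨φ, φd, φs, φsub, φ1, W, hWo, hxW, hW, φW⟩ := exists_contDiff_eq_one_near hx₀
  obtain ⟨ψ, ψd, ψs, ψsub, ψ1, Z, hZo, hyZ, hZ, ψZ⟩ := exists_contDiff_eq_one_near hy₀
  obtain ⟨K₁, hK₁⟩ := exists_forall_abs_deriv_le_of_hasCompactSupport φd φs
  obtain ⟨K₂, hK₂⟩ := exists_forall_abs_deriv_le_of_hasCompactSupport ψd ψs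
  have hM0 : 0 ≤ M := (abs_nonneg _).trans (hMx x₀ hx₀ y₀ hy₀).1
  have φz : ∀ x ∉ Ioo a b, φ x = 0 := fun x h =>
    image_eq_zero_of_notMem_tsupport fun h' => h (φsub h')
  have ψz : ∀ y ∉ Ioo c d, ψ y = 0 := fun y h =>
    image_eq_zero_of_notMem_tsupport fun h' => h (ψsub h')
  have sc : ∀ {p q : ℝ}, |p| ≤ 1 → |q| ≤ M → |p * q| ≤ M := fun hp hq => by
    rw [abs_mul]
    exact (mul_le_mul hp hq (abs_nonneg _) zero_le_one).trans_eq (one_mul M)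
  let g : ℝ × ℝ → ℝ := fun p => φ p.1 * (ψ p.2 * f p.1 p.2)
  let u : ℝ × ℝ → ℝ := fun p => deriv φ p.1 * (ψ p.2 * f p.1 p.2) + φ p.1 * (ψ p.2 * fx p.1 p.2)
  let w : ℝ × ℝ → ℝ := fun p => deriv ψ p.2 * (φ p.1 * f p.1 p.2) + ψ p.2 * (φ p.1 * fy p.1 p.2)
  have hu := fun y => hasDerivAt_and_lipschitz_cutoff_mul (F := fun s => ψ y * f s y)
    (F' := fun s => ψ y * fx s y) (F'' := fun s => ψ y * fxx s y) (S := Ioo a b) (M := M)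
    hM0 φd φsub hK₁
    (fun x hx' => by
      by_cases hy' : y ∈ Ioo c d
      · exact ⟨(hx x hx' y hy').1.const_mul _, (hx x hx' y hy').2.const_mul _⟩
      · simp only [ψz y hy', zero_mul]
        exact ⟨hasDerivAt_const _ _, hasDerivAt_const _ _⟩)
    (fun x hx' => by
      by_cases hy' : y ∈ Ioo c d
      · obtain ⟨h1, h2, h3⟩ := hMx x hx' y hy'
        exact ⟨sc (ψ1 y) h1, sc (ψ1 y) h2, sc (ψ1 y) h3⟩
      · simp [ψz y hy', hM0])
  have hw := fun x => hasDerivAt_and_lipschitz_cutoff_mul (F := fun t => φ x * f x t)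
    (F' := fun t => φ x * fy x t) (F'' := fun t => φ x * fyy x t) (S := Ioo c d) (M := M)
    hM0 ψd ψsub hK₂
    (fun y hy' => by
      by_cases hx' : x ∈ Ioo a b
      · exact ⟨(hy x hx' y hy').1.const_mul _, (hy x hx' y hy').2.const_mul _⟩
      · simp only [φz x hx', zero_mul]
        exact ⟨hasDerivAt_const _ _, hasDerivAt_const _ _⟩)
    (fun y hy' => by
      by_cases hx' : x ∈ Ioo a b
      · obtain ⟨h1, h2, h3⟩ := hMy x hx' y hy'
        exact ⟨sc (φ1 x) h1, sc (φ1 x) h2, sc (φ1 x) h3⟩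
      · simp [φz x hx', hM0])
  have hsupp : tsupport g ⊆ tsupport φ ×ˢ tsupport ψ := by
    refine closure_minimal (fun p hp => ?_) ((isClosed_tsupport φ).prod (isClosed_tsupport ψ))
    have hp' : φ p.1 * (ψ p.2 * f p.1 p.2) ≠ 0 := hp
    exact ⟨subset_tsupport φ (left_ne_zero_of_mul hp'),
      subset_tsupport ψ (left_ne_zero_of_mul (right_ne_zero_of_mul hp'))⟩
  have hgs : HasCompactSupport g :=
    (φs.isCompact.prod ψs.isCompact).of_isClosed_subset (isClosed_tsupport g) hsupp
  -- Joint continuity of f: continuous in y, and Lipschitz in x with a constant independent of y.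
  have hfc : ContinuousOn (fun p : ℝ × ℝ => f p.1 p.2) (Ioo a b ×ˢ Ioo c d) := by
    refine continuousOn_prod_of_continuousOn_lipschitzOnWith _ M.toNNReal
      (fun x hx' y hy' => (hy x hx' y hy').1.continuousAt.continuousWithinAt) fun y hy' => ?_
    refine (convex_Ioo a b).lipschitzOnWith_of_nnnorm_hasDerivWithin_le
      (fun x hx' => (hx x hx' y hy').1.hasDerivWithinAt) fun x hx' => ?_
    rw [← NNReal.coe_le_coe, Real.coe_toNNReal _ hM0]
    exact (hMx x hx' y hy').2.1
  have hgc : Continuous g := by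
    refine continuous_of_tsupport fun p hp => ?_
    have hp' := hsupp hp
    have hmem : p ∈ Ioo a b ×ˢ Ioo c d := ⟨φsub hp'.1, ψsub hp'.2⟩
    have := hfc.continuousAt ((isOpen_Ioo.prod isOpen_Ioo).mem_nhds hmem)
    have h1 := φd.continuous
    have h2 := ψd.continuous
    fun_prop
  have e : ∀ x y, φ x * (ψ y * f x y) = ψ y * (φ x * f x y) := fun x y => mul_left_comm _ _ _
  have main := ae_exists_hasDerivAt_mixed (g := g) (u := u) (w := w)
    (M := max (4 * (K₁ * M)) (4 * (K₂ * M))) hgc hgs (fun x y => (hu y).1 x)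
    (fun x x' y => ((hu y).2 x x').trans
      (mul_le_mul_of_nonneg_right (le_max_left _ _) (abs_nonneg _)))
    (fun x y => by simp only [g, e]; exact (hw x).1 y)
    (fun x y y' => ((hw x).2 y y').trans
      (mul_le_mul_of_nonneg_right (le_max_right _ _) (abs_nonneg _)))
  refine ⟨W ×ˢ Z, hWo.prod hZo, ⟨hxW, hyZ⟩, prod_mono hW hZ, ?_⟩
  have φ' : ∀ x ∈ W, deriv φ x = 0 := fun x hx' => by
    have : φ =ᶠ[𝓝 x] fun _ => 1 := by
      filter_upwards [hWo.mem_nhds hx'] with s hs using φW s hs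
    simpa using this.deriv_eq
  have ψ' : ∀ y ∈ Z, deriv ψ y = 0 := fun y hy' => by
    have : ψ =ᶠ[𝓝 y] fun _ => 1 := by
      filter_upwards [hZo.mem_nhds hy'] with s hs using ψZ s hs
    simpa using this.deriv_eq
  filter_upwards [main] with p hp hpV
  obtain ⟨v, hv1, hv2⟩ := hp
  refine ⟨v, hv1.congr_of_eventuallyEq ?_, hv2.congr_of_eventuallyEq ?_⟩
  · filter_upwards [hZo.mem_nhds hpV.2] with t ht
    simp [u, φ' _ hpV.1, φW _ hpV.1, ψZ t ht]
  · filter_upwards [hWo.mem_nhds hpV.1] with s hs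
    simp [w, ψ' _ hpV.2, ψZ _ hpV.2, φW s hs]

/-! ### Uniform bounds from Baire's theorem -/

/-- Baire's theorem on an interval, for a countable cover by relatively closed sets. -/
theorem exists_Ioo_subset_of_countable_cover {ι : Type*} [Countable ι] {c d : ℝ} (hcd : c < d)
    (C : ι → Set ℝ) (hC : ∀ i, ∀ y ∈ Ioo c d, y ∈ closure (C i ∩ Ioo c d) → y ∈ C i)
    (hcov : ∀ y ∈ Ioo c d, ∃ i, y ∈ C i) :
    ∃ i c' d', c' < d' ∧ Ioo c' d' ⊆ Ioo c d ∧ Ioo c' d' ⊆ C i := by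
  -- The complement of the interval is added as one more closed set, so that Baire's theorem applies
  -- on all of ℝ.
  let E : Option ι → Set ℝ := fun o => o.elim (Ioo c d)ᶜ fun i => closure (C i ∩ Ioo c d)
  have hE : ∀ o, IsClosed (E o) := by
    rintro (_ | i)
    · exact isOpen_Ioo.isClosed_compl
    · exact isClosed_closure
  have hU : ⋃ o, E o = univ := by
    refine eq_univ_of_forall fun y => mem_iUnion.2 ?_
    by_cases hy : y ∈ Ioo c d
    · obtain ⟨i, hi⟩ := hcov y hy
      exact ⟨some i, subset_closure ⟨hi, hy⟩⟩
    · exact ⟨none, hy⟩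
  obtain ⟨y, hy, hy'⟩ := (dense_iUnion_interior_of_closed hE hU).inter_open_nonempty _
    isOpen_Ioo (nonempty_Ioo.2 hcd)
  obtain ⟨o, ho⟩ := mem_iUnion.1 hy'
  rcases o with _ | i
  · exact absurd hy (interior_subset ho)
  · obtain ⟨c', d', hm, hsub⟩ := mem_nhds_iff_exists_Ioo_subset.1
      (inter_mem (isOpen_interior.mem_nhds ho) (isOpen_Ioo.mem_nhds hy))
    exact ⟨i, c', d', hm.1.trans hm.2, fun z hz => (hsub hz).2,
      fun z hz => hC i z (hsub hz).2 (interior_subset (hsub hz).1)⟩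

/-- A twice differentiable function is, with its derivative, bounded and Lipschitz on some interval
with rational end points. -/
theorem exists_rat_Ioo_bounded_lipschitz {F F' F'' : ℝ → ℝ} {a b : ℝ} (hab : a < b)
    (hF : ∀ x ∈ Ioo a b, HasDerivAt F (F' x) x ∧ HasDerivAt F' (F'' x) x) :
    ∃ (p q : ℚ) (n : ℕ), (p : ℝ) < q ∧ Ioo (p : ℝ) q ⊆ Ioo a b ∧ ∀ x ∈ Ioo (p : ℝ) q,
      |F x| ≤ n ∧ |F' x| ≤ n ∧ ∀ x' ∈ Ioo (p : ℝ) q, |F' x - F' x'| ≤ n * |x - x'| := by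
  obtain ⟨n, a', b', hab', hsub, hC⟩ := exists_Ioo_subset_of_countable_cover hab
    (fun n : ℕ => {x | |F x| ≤ n ∧ |F' x| ≤ n ∧
      ∀ x' ∈ Ioo a b, |x - x'| < 1 / ((n : ℝ) + 1) → |F' x - F' x'| ≤ n * |x - x'|})
    (by
      intro n x hx hcl
      have cF := (hF x hx).1.continuousAt
      have cF' := (hF x hx).2.continuousAt
      refine ⟨ContinuousWithinAt.closure_le hcl cF.abs.continuousWithinAt
          continuousWithinAt_const fun z hz => hz.1.1,
        ContinuousWithinAt.closure_le hcl cF'.abs.continuousWithinAt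
          continuousWithinAt_const fun z hz => hz.1.2.1, fun x' hx' hd => ?_⟩
      have hcl' := (isOpen_lt (by fun_prop) continuous_const :
        IsOpen {z : ℝ | |z - x'| < 1 / ((n : ℝ) + 1)}).inter_closure ⟨hd, hcl⟩
      refine ContinuousWithinAt.closure_le hcl'
        (f := fun z => |F' z - F' x'|) (g := fun z => n * |z - x'|)
        (cF'.sub continuousAt_const).abs.continuousWithinAt
        (by fun_prop) fun z hz => hz.2.1.2.2 x' hx' hz.1)
    (by
      intro x hx
      have hO := (hF x hx).2.differentiableAt.isBigO_sub
      obtain ⟨A, hA⟩ := hO.bound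
      obtain ⟨r, hr, hball⟩ := Metric.eventually_nhds_iff.1 hA
      obtain ⟨n₁, hn₁⟩ := exists_nat_one_div_lt hr
      obtain ⟨n₂, hn₂⟩ := exists_nat_ge (max (max |F x| |F' x|) A)
      have hle : (n₂ : ℝ) ≤ ((max n₁ n₂ : ℕ) : ℝ) := by exact_mod_cast le_max_right n₁ n₂
      have hle' : (n₁ : ℝ) ≤ ((max n₁ n₂ : ℕ) : ℝ) := by exact_mod_cast le_max_left n₁ n₂
      refine ⟨max n₁ n₂, ((le_max_left _ _).trans (le_max_left _ _)).trans (hn₂.trans hle),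
        ((le_max_right _ _).trans (le_max_left _ _)).trans (hn₂.trans hle), fun x' _ hd => ?_⟩
      have hd' : dist x' x < r := by
        rw [dist_comm, Real.dist_eq]
        refine hd.trans (lt_of_le_of_lt ?_ hn₁)
        exact one_div_le_one_div_of_le (by positivity) (by linarith)
      have := hball hd'
      rw [Real.norm_eq_abs, Real.norm_eq_abs, abs_sub_comm, abs_sub_comm x'] at this
      exact this.trans (mul_le_mul_of_nonneg_right
        ((le_max_right _ _).trans (hn₂.trans hle)) (abs_nonneg _)))
  have hpos : (0 : ℝ) < 1 / ((n : ℝ) + 1) := by positivity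
  obtain ⟨p, hp1, hp2⟩ := exists_rat_btwn hab'
  -- With q - p < 1/(n+1), any two points of the interval are close enough for the local Lipschitz
  -- condition.
  obtain ⟨q, hq1, hq2⟩ := exists_rat_btwn (lt_min hp2 (lt_add_of_pos_right (p : ℝ) hpos))
  have hsub' : Ioo (p : ℝ) q ⊆ Ioo a' b' :=
    Ioo_subset_Ioo hp1.le (hq2.le.trans (min_le_left _ _))
  have hq3 := hq2.trans_le (min_le_right _ _)
  refine ⟨p, q, n, hq1, hsub'.trans hsub, fun x hx => ?_⟩
  obtain ⟨h1, h2, h3⟩ := hC (hsub' hx)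
  refine ⟨h1, h2, fun x' hx' => h3 x' (hsub (hsub' hx')) ?_⟩
  rw [abs_lt]
  constructor <;> linarith [hx.1, hx.2, hx'.1, hx'.2]

/-- Pointwise existence of two derivatives in one variable implies uniform bounds on some
rectangle. -/
theorem exists_rectangle_bounded {f fx fxx : ℝ → ℝ → ℝ} {a b c d : ℝ} (hab : a < b) (hcd : c < d)
    (hx : ∀ x ∈ Ioo a b, ∀ y ∈ Ioo c d,
      HasDerivAt (fun s => f s y) (fx x y) x ∧ HasDerivAt (fun s => fx s y) (fxx x y) x)
    (hc : ∀ x ∈ Ioo a b, ∀ y ∈ Ioo c d, ContinuousAt (fun t => f x t) y) :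
    ∃ a' b' c' d' M : ℝ, a' < b' ∧ c' < d' ∧ Ioo a' b' ⊆ Ioo a b ∧ Ioo c' d' ⊆ Ioo c d ∧
      ∀ x ∈ Ioo a' b', ∀ y ∈ Ioo c' d', |f x y| ≤ M ∧ |fx x y| ≤ M ∧ |fxx x y| ≤ M := by
  -- The bounds on fx and its Lipschitz constant are encoded through increments of f alone:
  -- continuity in y is known for f but not for fx, and it is needed to make the sets relatively
  -- closed.
  obtain ⟨⟨p, q, n⟩, c', d', hcd', hsub, hC⟩ := exists_Ioo_subset_of_countable_cover hcd
    (fun i : ℚ × ℚ × ℕ => {y | ((i.1 : ℝ) < i.2.1 ∧ Ioo (i.1 : ℝ) i.2.1 ⊆ Ioo a b) ∧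
      (∀ x ∈ Ioo (i.1 : ℝ) i.2.1, |f x y| ≤ i.2.2) ∧
      (∀ x ∈ Ioo (i.1 : ℝ) i.2.1, ∀ x' ∈ Ioo (i.1 : ℝ) i.2.1,
        |f x y - f x' y| ≤ i.2.2 * |x - x'|) ∧
      ∀ x ∈ Ioo (i.1 : ℝ) i.2.1, ∀ x' ∈ Ioo (i.1 : ℝ) i.2.1, ∀ h : ℝ,
        x + h ∈ Ioo (i.1 : ℝ) i.2.1 → x' + h ∈ Ioo (i.1 : ℝ) i.2.1 →
        |(f (x + h) y - f x y) - (f (x' + h) y - f x' y)| ≤ i.2.2 * |x - x'| * |h|})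
    (by
      rintro ⟨p, q, n⟩ y hy hcl
      obtain ⟨z, hz⟩ : (_ : Set ℝ).Nonempty := closure_nonempty_iff.1 ⟨y, hcl⟩
      have hpq := hz.1.1
      have cf : ∀ x ∈ Ioo (p : ℝ) q, ContinuousAt (fun t => f x t) y :=
        fun x hx' => hc x (hpq.2 hx') y hy
      refine ⟨hpq, fun x hx' => ?_, fun x hx' x' hx'' => ?_, fun x hx' x' hx'' h hh hh' => ?_⟩
      · exact ContinuousWithinAt.closure_le hcl (cf x hx').abs.continuousWithinAt
          continuousWithinAt_const fun z hz => hz.1.2.1 x hx'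
      · exact ContinuousWithinAt.closure_le hcl
          ((cf x hx').sub (cf x' hx'')).abs.continuousWithinAt
          continuousWithinAt_const fun z hz => hz.1.2.2.1 x hx' x' hx''
      · exact ContinuousWithinAt.closure_le hcl
          (((cf _ hh).sub (cf x hx')).sub ((cf _ hh').sub (cf x' hx''))).abs.continuousWithinAt
          continuousWithinAt_const fun z hz => hz.1.2.2.2 x hx' x' hx'' h hh hh')
    (by
      intro y hy
      obtain ⟨p, q, n, hpq, hs, hn⟩ := exists_rat_Ioo_bounded_lipschitz
        (F'' := fun s => fxx s y) hab fun x hx' => hx x hx' y hy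
      refine ⟨(p, q, n), ⟨hpq, hs⟩, fun x hx' => (hn x hx').1, fun x hx' x' hx'' => ?_,
        fun x hx' x' hx'' h hh hh' => ?_⟩
      · exact (convex_Ioo (p : ℝ) q).norm_image_sub_le_of_norm_hasDerivWithin_le
          (f := fun s => f s y) (fun z hz => (hx z (hs hz) y hy).1.hasDerivWithinAt)
          (fun z hz => (hn z hz).2.1) hx'' hx'
      · exact abs_increment_sub_increment_le (F := fun s => f s y) ordConnected_Ioo
          (fun z hz => (hx z (hs hz) y hy).1) (fun z hz => (hn z hz).2.2) hx' hx'' hh hh')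
  obtain ⟨z, hz⟩ := nonempty_Ioo.2 hcd'
  obtain ⟨hpq, hs⟩ := (hC hz).1
  refine ⟨p, q, c', d', n, hpq, hcd', hs, hsub, fun x hx' y hy' => ?_⟩
  obtain ⟨-, b1, b2, b3⟩ := hC hy'
  have hn : (0 : ℝ) ≤ n := n.cast_nonneg
  have hnhds := isOpen_Ioo.mem_nhds hx'
  obtain ⟨D1, D2⟩ := hx x (hs hx') y (hsub hy')
  -- Dividing the double increment by h and letting h → 0 recovers the Lipschitz bound for fx.
  have lip : ∀ x' ∈ Ioo (p : ℝ) q, |fx x' y - fx x y| ≤ n * |x' - x| := by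
    intro x' hx''
    have D1' := (hx x' (hs hx'') y (hsub hy')).1
    have D : HasDerivAt (fun h => f (x' + h) y - f (x + h) y) (fx x' y - fx x y) 0 := by
      refine HasDerivAt.sub ?_ ?_
      · exact HasDerivAt.comp_const_add x' 0 (by simpa using D1')
      · exact HasDerivAt.comp_const_add x 0 (by simpa using D1)
    rw [← D.deriv, ← Real.norm_eq_abs]
    have t : ∀ z ∈ Ioo (p : ℝ) q, ∀ᶠ h in 𝓝 (0 : ℝ), z + h ∈ Ioo (p : ℝ) q := fun z hz => by
      have : ContinuousAt (fun h : ℝ => z + h) 0 := by fun_prop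
      exact this.eventually_mem (isOpen_Ioo.mem_nhds (by simpa using hz))
    refine norm_deriv_le_of_lip' (by positivity) ?_
    filter_upwards [t x hx', t x' hx''] with h h1 h2
    have := b3 x' hx'' x hx' h h2 h1
    simp only [add_zero, sub_zero, Real.norm_eq_abs]
    convert! this using 2
    ring
  refine ⟨b1 x hx', ?_, ?_⟩
  · rw [← D1.deriv, ← Real.norm_eq_abs]
    refine norm_deriv_le_of_lip' hn ?_
    filter_upwards [hnhds] with s hs' using b2 s hs' x hx'
  · rw [← D2.deriv, ← Real.norm_eq_abs]
    refine norm_deriv_le_of_lip' hn ?_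
    filter_upwards [hnhds] with s hs' using lip s hs'

/-! ### Assembly on the square -/

/-- The x-bounds are obtained first; the second use of Baire's theorem, with the variables
exchanged, takes place inside that rectangle, so both sets of bounds hold on the final one. -/
theorem exists_open_ae_mixed {f fx fxx fy fyy : ℝ → ℝ → ℝ} {a b c d : ℝ} (hab : a < b)
    (hcd : c < d)
    (hx : ∀ x ∈ Ioo a b, ∀ y ∈ Ioo c d,
      HasDerivAt (fun s => f s y) (fx x y) x ∧ HasDerivAt (fun s => fx s y) (fxx x y) x)
    (hy : ∀ x ∈ Ioo a b, ∀ y ∈ Ioo c d,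
      HasDerivAt (fun t => f x t) (fy x y) y ∧ HasDerivAt (fun t => fy x t) (fyy x y) y) :
    ∃ V : Set (ℝ × ℝ), IsOpen V ∧ V.Nonempty ∧ V ⊆ Ioo a b ×ˢ Ioo c d ∧
      ∀ᵐ p : ℝ × ℝ, p ∈ V → ∃ v, HasDerivAt (fun t => fx p.1 t) v p.2 ∧
        HasDerivAt (fun s => fy s p.2) v p.1 := by
  obtain ⟨a₁, b₁, c₁, d₁, M₁, hab₁, hcd₁, hs₁, ht₁, hM₁⟩ := exists_rectangle_bounded hab hcd hx
    fun x hx' y hy' => (hy x hx' y hy').1.continuousAt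
  obtain ⟨c₂, d₂, a₂, b₂, M₂, hcd₂, hab₂, ht₂, hs₂, hM₂⟩ := exists_rectangle_bounded
    (f := fun y x => f x y) (fx := fun y x => fy x y) (fxx := fun y x => fyy x y) hcd₁ hab₁
    (fun y hy' x hx' => hy x (hs₁ hx') y (ht₁ hy'))
    fun y hy' x hx' => (hx x (hs₁ hx') y (ht₁ hy')).1.continuousAt
  obtain ⟨x₀, hx₀⟩ := nonempty_Ioo.2 hab₂
  obtain ⟨y₀, hy₀⟩ := nonempty_Ioo.2 hcd₂
  obtain ⟨V, hV, hmem, hsub, hae⟩ := ae_mixed_near_of_bounded (f := f) (fx := fx) (fxx := fxx)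
    (fy := fy) (fyy := fyy) (M := max M₁ M₂)
    (fun x hx' y hy' => hx x (hs₁ (hs₂ hx')) y (ht₁ (ht₂ hy')))
    (fun x hx' y hy' => hy x (hs₁ (hs₂ hx')) y (ht₁ (ht₂ hy')))
    (fun x hx' y hy' => by
      obtain ⟨h1, h2, h3⟩ := hM₁ x (hs₂ hx') y (ht₂ hy')
      exact ⟨le_max_of_le_left h1, le_max_of_le_left h2, le_max_of_le_left h3⟩)
    (fun x hx' y hy' => by
      obtain ⟨h1, h2, h3⟩ := hM₂ y hy' x hx'
      exact ⟨le_max_of_le_right h1, le_max_of_le_right h2, le_max_of_le_right h3⟩) hx₀ hy₀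
  exact ⟨V, hV, ⟨_, hmem⟩, hsub.trans (prod_mono (hs₂.trans hs₁) (ht₂.trans ht₁)), hae⟩

namespace UnitSquare

theorem HasDx.hasDerivAt {f : ℝ → ℝ → ℝ} {x y : ℝ} (h : HasDx f x y) (hx : x ∈ Ioo (0 : ℝ) 1) :
    HasDerivAt (fun s => f s y) (Dx f x y) x :=
  h.hasDerivWithinAt.hasDerivAt (Icc_mem_nhds hx.1 hx.2)

theorem HasDy.hasDerivAt {f : ℝ → ℝ → ℝ} {x y : ℝ} (h : HasDy f x y) (hy : y ∈ Ioo (0 : ℝ) 1) :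
    HasDerivAt (fun t => f x t) (Dy f x y) y :=
  h.hasDerivWithinAt.hasDerivAt (Icc_mem_nhds hy.1 hy.2)

end UnitSquare

theorem corollary4p2 (f : ℝ → ℝ → ℝ)
    (hx : ∀ x ∈ Icc (0 : ℝ) 1, ∀ y ∈ Icc (0 : ℝ) 1,
      UnitSquare.HasDx f x y ∧ UnitSquare.HasDx (UnitSquare.Dx f) x y)
    (hy : ∀ x ∈ Icc (0 : ℝ) 1, ∀ y ∈ Icc (0 : ℝ) 1,
      UnitSquare.HasDy f x y ∧ UnitSquare.HasDy (UnitSquare.Dy f) x y) :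
    ∃ G : Set (ℝ × ℝ),
      (∃ U : Set (ℝ × ℝ), IsOpen U ∧ G = U ∩ UnitSquare.square) ∧
      UnitSquare.square ⊆ closure G ∧
      ∀ᵐ p : ℝ × ℝ ∂volume, p ∈ G →
        UnitSquare.HasDy (UnitSquare.Dx f) p.1 p.2 ∧
        UnitSquare.HasDx (UnitSquare.Dy f) p.1 p.2 ∧
        UnitSquare.Dy (UnitSquare.Dx f) p.1 p.2 = UnitSquare.Dx (UnitSquare.Dy f) p.1 p.2 := by
  let P : ℝ × ℝ → Prop := fun p => ∃ v, HasDerivAt (fun t => UnitSquare.Dx f p.1 t) v p.2 ∧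
    HasDerivAt (fun s => UnitSquare.Dy f s p.2) v p.1
  let A : Set (Set (ℝ × ℝ)) :=
    {V | IsOpen V ∧ V ⊆ Ioo (0 : ℝ) 1 ×ˢ Ioo (0 : ℝ) 1 ∧ ∀ᵐ p : ℝ × ℝ, p ∈ V → P p}
  have hsq : Ioo (0 : ℝ) 1 ×ˢ Ioo (0 : ℝ) 1 ⊆ UnitSquare.square :=
    prod_mono Ioo_subset_Icc_self Ioo_subset_Icc_self
  have hA : ⋃₀ A ⊆ Ioo (0 : ℝ) 1 ×ˢ Ioo (0 : ℝ) 1 := sUnion_subset fun V hV => hV.2.1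
  refine ⟨⋃₀ A, ⟨⋃₀ A, isOpen_sUnion fun V hV => hV.1,
    (inter_eq_left.2 (hA.trans hsq)).symm⟩, ?_, ?_⟩
  · have hcl : UnitSquare.square = closure (Ioo (0 : ℝ) 1 ×ˢ Ioo (0 : ℝ) 1) := by
      rw [closure_prod_eq, closure_Ioo zero_ne_one, UnitSquare.square]
    rw [hcl]
    refine closure_minimal (fun q hq => ?_) isClosed_closure
    rw [mem_closure_iff_nhds]
    intro N hN
    have hO : IsOpen (Ioo (0 : ℝ) 1 ×ˢ Ioo (0 : ℝ) 1) := isOpen_Ioo.prod isOpen_Ioo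
    obtain ⟨ε, hε, hball⟩ := Metric.mem_nhds_iff.1 (inter_mem hN (hO.mem_nhds hq))
    have hball' : Ioo (q.1 - ε) (q.1 + ε) ×ˢ Ioo (q.2 - ε) (q.2 + ε) ⊆
        N ∩ Ioo (0 : ℝ) 1 ×ˢ Ioo (0 : ℝ) 1 := by
      rw [← Real.ball_eq_Ioo, ← Real.ball_eq_Ioo, ball_prod_same]
      exact hball
    obtain ⟨V, hV, ⟨p, hp⟩, hVs, hae⟩ := exists_open_ae_mixed (f := f) (fx := UnitSquare.Dx f)
      (fxx := UnitSquare.Dx (UnitSquare.Dx f)) (fy := UnitSquare.Dy f)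
      (fyy := UnitSquare.Dy (UnitSquare.Dy f))
      (by linarith : q.1 - ε < q.1 + ε) (by linarith : q.2 - ε < q.2 + ε)
      (fun x hx' y hy' => by
        have hm := (hball' (mk_mem_prod hx' hy')).2
        have := hx x (hsq hm).1 y (hsq hm).2
        exact ⟨this.1.hasDerivAt hm.1, this.2.hasDerivAt hm.1⟩)
      (fun x hx' y hy' => by
        have hm := (hball' (mk_mem_prod hx' hy')).2
        have := hy x (hsq hm).1 y (hsq hm).2
        exact ⟨this.1.hasDerivAt hm.2, this.2.hasDerivAt hm.2⟩)
    exact ⟨p, (hball' (hVs hp)).1, V, ⟨hV, fun z hz => (hball' (hVs hz)).2, hae⟩, hp⟩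
  · have hnull : volume {p : ℝ × ℝ | p ∈ ⋃₀ A ∧ ¬ P p} = 0 := by
      refine measure_null_of_locally_null _ fun p hp => ?_
      obtain ⟨V, hV, hpV⟩ := hp.1
      refine ⟨V ∩ {p : ℝ × ℝ | p ∈ ⋃₀ A ∧ ¬ P p}, inter_comm _ _ ▸
        inter_mem_nhdsWithin _ (hV.1.mem_nhds hpV), ?_⟩
      refine measure_mono_null (fun z hz => ?_) (ae_iff.1 hV.2.2)
      exact fun h => hz.2.2 (h hz.1)
    have hae : ∀ᵐ p : ℝ × ℝ, ¬ (p ∈ ⋃₀ A ∧ ¬ P p) := by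
      rw [ae_iff]; simpa only [not_not] using hnull
    filter_upwards [hae] with p hp hpG
    obtain ⟨v, hv1, hv2⟩ : P p := by_contra fun h => hp ⟨hpG, h⟩
    have hps := hsq (hA hpG)
    have hu := uniqueDiffOn_Icc (zero_lt_one (α := ℝ))
    exact ⟨hv1.differentiableAt.differentiableWithinAt,
      hv2.differentiableAt.differentiableWithinAt,
      (hv1.hasDerivWithinAt.derivWithin (hu _ hps.2)).trans
        (hv2.hasDerivWithinAt.derivWithin (hu _ hps.1)).symm⟩
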